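/- Let $(U_n)_{n\in\mathbb N}$ be any universal Martin-Löf test on Cantor space $\{0,1\}^{\mathbb N}$ (a computable sequence of open sets with $\lambda(U_n)\le 2^{-n}$ whose intersection contains the intersection of every other Martin-Löf test), and let $\mathrm{MLR}=\{0,1\}^{\mathbb N}\setminus\bigcap_n U_n$ be the set of Martin-Löf random sequences. Let $\mathrm{LAY}:\mathrm{MLR}\rightrightarrows\mathbb N$ be the multivalued function with $n\in\mathrm{LAY}(p)$ iff $p\notin U_n$. Let $\mathrm C_{\mathbb N}$ be closed choice on $\mathbb N$: given an enumeration of the complement of a non-empty set $A\subseteq\mathbb N$ (a sequence $p$ with $n\notin A\Leftrightarrow\exists i\;p(i)=n+1$), find an element of $A$. For a multivalued function $f$ between represented spaces let $f^0=\mathrm{id}_{\mathbb N^{\mathbb N}}$, $f^{n+1}=f^n\times f$, and let $f^*$ be defined on the pairs $(n,x)$ with $n\in\mathbb N$, $x\in\operatorname{dom}(f^n)$ by $f^*(n,x)=f^n(x)$. Let $f+g$ denote the coproduct of $f$ and $g$: on the disjoint union of the domains, it applies $f$ to inputs from the first summand and $g$ to inputs from the second. Write $f\le_{\mathrm W}g$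 (Weihrauch reducibility) if there are computable $K,H:\subseteq\mathbb N^{\mathbb N}\to\mathbb N^{\mathbb N}$ such that $p\mapsto K\langle p,G(H(p))\rangle$ is a realizer of $f$ for every realizer $G$ of $g$; let $\equiv_{\mathrm W}$ be the induced equivalence, and $f<_{\mathrm W}g$ mean $f\le_{\mathrm W}g$ and $g\not\le_{\mathrm W}f$. Then $$\mathrm{LAY}\;<_{\mathrm W}\;\mathrm{LAY}^*\;\equiv_{\mathrm W}\;\mathrm{id}_{\mathbb N^{\mathbb N}}+\mathrm{LAY}\;<_{\mathrm W}\;\mathrm C_{\mathbb N}.$$ -/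

import Mathlib

noncomputable section

namespace Weihrauch

/-! Computability on Baire space -/

/-- Baire space. -/
abbrev Baire : Type := ℕ → ℕ

/-- Cantor space. -/
abbrev Cantor : Type := ℕ → Bool

/-- The prefix of length `n` of an infinite sequence. -/
def pre {α : Type} (p : ℕ → α) (n : ℕ) : List α := (List.range n).map p

/-- A partial function on Baire space is computable if a Type-2 machine computes it.
The machine is given by its action on finite prefixes: `φ u` is the output written on the
one-way output tape when only the finite input prefix `u` is available (within `u.length`
steps). It is a computable word function, monotone for the prefix order, and for every `p` in
the domain of `F` the words `φ (pre p n)` are prefixes of `F p` of unbounded length. As usual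
for partial functions, nothing is required for inputs outside of the domain. -/
def IsComputable (F : Baire →. Baire) : Prop :=
  ∃ φ : List ℕ → List ℕ, Computable φ ∧ (∀ u v, u <+: v → φ u <+: φ v) ∧
    ∀ p q, q ∈ F p →
      (∀ n, φ (pre p n) = pre q (φ (pre p n)).length) ∧
      ∀ m, ∃ n, m ≤ (φ (pre p n)).length

/-- The standard pairing function on Baire space. -/
def pair (p q : Baire) : Baire := fun n => if n % 2 = 0 then p (n / 2) else q (n / 2)

/-- First component of a paired sequence. -/
def evenPart (r : Baire) : Baire := fun n => r (2 * n)

/-- Second component of a paired sequence. -/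
def oddPart (r : Baire) : Baire := fun n => r (2 * n + 1)

/-- Prepend a natural number. -/
def cons (n : ℕ) (p : Baire) : Baire := fun i => Nat.casesOn i n p

/-- Remove the first entry. -/
def tail (p : Baire) : Baire := fun i => p (i + 1)

theorem evenPart_pair (p q : Baire) : evenPart (pair p q) = p := by
  funext n
  simp [evenPart, pair]

theorem oddPart_pair (p q : Baire) : oddPart (pair p q) = q := by
  funext n
  have h : (2 * n + 1) / 2 = n := by omega
  simp [oddPart, pair, h, Nat.add_mod]

theorem tail_cons (n : ℕ) (p : Baire) : tail (cons n p) = p := rfl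

theorem cons_zero (n : ℕ) (p : Baire) : cons n p 0 = n := rfl

/-! Represented spaces -/

/-- A represented space: a set with a partial surjection from Baire space onto it. -/
structure RepSpace : Type 1 where
  Carrier : Type
  rep : Baire →. Carrier
  surj : ∀ x : Carrier, ∃ p : Baire, x ∈ rep p

/-- Baire space, represented by the identity. -/
abbrev baireSpace : RepSpace where
  Carrier := Baire
  rep := fun p => Part.some p
  surj := fun x => ⟨x, Part.mem_some x⟩

/-- The natural numbers; `n` is named by all `p` that start with `n`. -/
abbrev natSpace : RepSpace where
  Carrier := ℕ
  rep := fun p => Part.some (p 0)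
  surj := fun n => ⟨fun _ => n, Part.mem_some n⟩

/-- Cantor space; each binary sequence is named by itself. -/
abbrev cantorSpace : RepSpace where
  Carrier := Cantor
  rep := fun p => ⟨∀ i, p i = 0 ∨ p i = 1, fun _ i => decide (p i = 1)⟩
  surj := fun x => ⟨fun i => (x i).toNat, by
    refine ⟨fun i => ?_, ?_⟩
    · cases x i <;> simp
    · funext i
      cases h : x i <;> simp [h]⟩

/-- The hyperspace of closed subsets of `ℕ`: a name enumerates the complement, where the
entry `n + 1` means that `n` is not in the set (and the entry `0` carries no information). -/
abbrev closedNat : RepSpace where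
  Carrier := Set ℕ
  rep := fun p => Part.some {n | ¬ ∃ i, p i = n + 1}
  surj := fun A => by
    classical
    refine ⟨fun i => if i ∈ A then 0 else i + 1, ?_⟩
    rw [Part.mem_some_iff]
    ext n
    simp only [Set.mem_ofPred_eq, not_exists]
    constructor
    · intro hn i h
      by_cases hi : i ∈ A
      · simp [hi] at h
      · simp only [hi, if_false, Nat.add_right_cancel_iff] at h
        exact hi (h ▸ hn)
    · intro h
      by_contra hn
      exact h n (by simp [hn])

/-- Binary product. -/
def RepSpace.prod (X Y : RepSpace) : RepSpace where
  Carrier := X.Carrier × Y.Carrier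
  rep := fun r => (X.rep (evenPart r)).bind fun x => (Y.rep (oddPart r)).map fun y => (x, y)
  surj := fun ⟨x, y⟩ => by
    obtain ⟨p, hp⟩ := X.surj x
    obtain ⟨q, hq⟩ := Y.surj y
    refine ⟨pair p q, ?_⟩
    rw [evenPart_pair, oddPart_pair]
    exact Part.mem_bind hp (Part.mem_map _ hq)

/-- Binary coproduct (disjoint union); the first entry of a name tells the side. -/
def RepSpace.sum (X Y : RepSpace) : RepSpace where
  Carrier := X.Carrier ⊕ Y.Carrier
  rep := fun p =>
    if p 0 = 0 then (X.rep (tail p)).map Sum.inl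
    else if p 0 = 1 then (Y.rep (tail p)).map Sum.inr
    else Part.none
  surj := fun z => by
    cases z with
    | inl x =>
      obtain ⟨p, hp⟩ := X.surj x
      refine ⟨cons 0 p, ?_⟩
      rw [cons_zero, if_pos rfl, tail_cons]
      exact Part.mem_map _ hp
    | inr y =>
      obtain ⟨p, hp⟩ := Y.surj y
      refine ⟨cons 1 p, ?_⟩
      rw [cons_zero, if_neg one_ne_zero, if_pos rfl, tail_cons]
      exact Part.mem_map _ hp

/-- Countable coproduct; the first entry of a name tells the index. -/
def RepSpace.sigma (X : ℕ → RepSpace) : RepSpace where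
  Carrier := Σ n, (X n).Carrier
  rep := fun p => ((X (p 0)).rep (tail p)).map fun x => ⟨p 0, x⟩
  surj := fun ⟨n, x⟩ => by
    obtain ⟨p, hp⟩ := (X n).surj x
    exact ⟨cons n p, Part.mem_map (fun x => (⟨n, x⟩ : Σ n, (X n).Carrier)) hp⟩

/-- The space `X ^ n`, with `X ^ 0` the Baire space and `X ^ (n + 1) = X ^ n × X`. -/
def RepSpace.pow (X : RepSpace) : ℕ → RepSpace
  | 0 => baireSpace
  | n + 1 => (X.pow n).prod X

/-! Multivalued functions and Weihrauch reducibility -/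

/-- Partial multivalued functions between represented spaces; the domain consists of
those points that have at least one value. -/
def MultiFun (X Y : RepSpace) : Type := X.Carrier → Set Y.Carrier

/-- The domain of a partial multivalued function. -/
def MultiFun.dom {X Y : RepSpace} (f : MultiFun X Y) : Set X.Carrier := {x | (f x).Nonempty}

/-- `F` is a realizer of `f`. -/
def Realizes {X Y : RepSpace} (F : Baire →. Baire) (f : MultiFun X Y) : Prop :=
  ∀ p x, x ∈ X.rep p → x ∈ f.dom → ∃ q ∈ F p, ∃ y ∈ Y.rep q, y ∈ f x

/-- Weihrauch reducibility: `p ↦ K ⟨p, G (H p)⟩` realizes `f` whenever `G` realizes `g`. -/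
def Reducible {X Y Z W : RepSpace} (f : MultiFun X Y) (g : MultiFun Z W) : Prop :=
  ∃ K H : Baire →. Baire, IsComputable K ∧ IsComputable H ∧
    ∀ G : Baire →. Baire, Realizes G g →
      Realizes (fun p => (H p).bind fun r => (G r).bind fun s => K (pair p s)) f

/-- Weihrauch equivalence. -/
def Equivalent {X Y Z W : RepSpace} (f : MultiFun X Y) (g : MultiFun Z W) : Prop :=
  Reducible f g ∧ Reducible g f

/-- Strict Weihrauch reducibility. -/
def StrictlyReducible {X Y Z W : RepSpace} (f : MultiFun X Y) (g : MultiFun Z W) : Prop :=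
  Reducible f g ∧ ¬ Reducible g f

/-- The identity on Baire space. -/
def idBaire : MultiFun baireSpace baireSpace := fun p => {p}

/-- The product `f × g`. -/
def MultiFun.prod {X Y Z W : RepSpace} (f : MultiFun X Y) (g : MultiFun Z W) :
    MultiFun (X.prod Z) (Y.prod W) :=
  fun x => f x.1 ×ˢ g x.2

/-- The coproduct `f + g`. -/
def MultiFun.sum {X Y Z W : RepSpace} (f : MultiFun X Y) (g : MultiFun Z W) :
    MultiFun (X.sum Z) (Y.sum W) :=
  fun x => Sum.elim (fun a => Sum.inl '' f a) (fun b => Sum.inr '' g b) x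

/-- The finite powers `f ^ 0 = id` (on Baire space) and `f ^ (n + 1) = f ^ n × f`. -/
def MultiFun.pow {X Y : RepSpace} (f : MultiFun X Y) : (n : ℕ) → MultiFun (X.pow n) (Y.pow n)
  | 0 => idBaire
  | n + 1 => (f.pow n).prod f

/-- The finite parallelization `f* (n, x) = f ^ n (x)`. -/
def MultiFun.star {X Y : RepSpace} (f : MultiFun X Y) :
    MultiFun (RepSpace.sigma X.pow) (RepSpace.sigma Y.pow) :=
  fun x => Sigma.mk x.1 '' f.pow x.1 x.2

/-- Closed choice on the natural numbers. -/
def choiceNat : MultiFun closedNat natSpace := fun A => {n : ℕ | n ∈ (A : Set ℕ)}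

/-! Martin-Löf tests and the layer problem -/

/-- The set of all infinite binary sequences that start with the word `w`. -/
def cylinder (w : List Bool) : Set Cantor := {p | pre p w.length = w}

/-- A computable sequence of open subsets of Cantor space: uniformly in `i`, a (finite or
infinite) list of words is computed whose cylinders have the union `U i`. -/
def IsComputableOpenSeq (U : ℕ → Set Cantor) : Prop :=
  ∃ w : ℕ → ℕ → Option (List Bool), Computable₂ w ∧
    ∀ i, U i = {p | ∃ j, ∃ v ∈ w i j, p ∈ cylinder v}

/-- The Lebesgue (fair coin) measure on Cantor space. -/
def coinMeasure : MeasureTheory.Measure Cantor :=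
  MeasureTheory.Measure.infinitePi fun _ : ℕ => (PMF.uniformOfFintype Bool).toMeasure

/-- Martin-Löf tests. -/
def IsMLTest (U : ℕ → Set Cantor) : Prop :=
  IsComputableOpenSeq U ∧ ∀ i, coinMeasure (U i) ≤ (2⁻¹ : ENNReal) ^ i

/-- Universal Martin-Löf tests. -/
def IsUniversalMLTest (U : ℕ → Set Cantor) : Prop :=
  IsMLTest U ∧ ∀ V : ℕ → Set Cantor, IsMLTest V → (⋂ i, V i) ⊆ ⋂ i, U i

/-- The sequences that pass the test `U`; for a universal test these are the
Martin-Löf random sequences. -/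
def randomSet (U : ℕ → Set Cantor) : Set Cantor := (⋂ i, U i)ᶜ

/-- The layer problem of the test `U`: given a sequence that passes the test, find an `n` such
that the sequence is not in `U n`. -/
def layer (U : ℕ → Set Cantor) : MultiFun cantorSpace natSpace := fun p => {n : ℕ | p ∉ U n}

theorem dom_layer (U : ℕ → Set Cantor) : (layer U).dom = randomSet U := by
  ext p
  change (∃ n, p ∉ U n) ↔ ¬ p ∈ ⋂ i, U i
  rw [Set.mem_iInter, not_forall]

end Weihrauch

end

noncomputable section

namespace Weihrauch

/-! Prefixes and computability of functions on Baire space -/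

/-! The substantial reduction is `LAY* ≤ id + LAY`. An empty tuple goes to the identity. A non-empty
tuple of random sequences is merged into one sequence `q` by copying the last entry bit by bit,
except that a zero is written whenever some `U c` (with `c` below the current stage) has been seen
to contain an entry but not yet the current output word.

If an entry lay in `U c` but `q` did not, `q` would be zero from some point on, hence computable,
and every computable sequence lies in all components of a universal test. So `q` is in each `U c`
that contains an entry (`mergeSeq_mem`), and any `n` with `q ∉ U n` solves all entries at once.
Moreover `q` is random (`mergeSeq_mem_randomSet`): random entries lie in only finitely many `U c`,
each of these is eventually seen to contain `q`, and from then on `q` agrees with the last entry.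
Randomness is invariant under finite changes.

For `id + LAY ≤ C_ℕ`, the set of `k` with `x ∉ U k` has a complement enumerable from `x`; on the
identity side the input is already the answer.

Both separations rest on computable instances. `LAY` has none in its domain, whereas `LAY*` has one
of index `0`. A reduction of `C_ℕ` to `id + LAY` must send the computable name `000…` of `ℕ` to the
identity side; the answer then depends continuously on the name, so excluding that answer late
enough is a contradiction. -/

@[simp]
theorem length_pre {α : Type} (p : ℕ → α) (n : ℕ) : (pre p n).length = n := by simp [pre]

theorem getElem?_pre {α : Type} (p : ℕ → α) (n i : ℕ) :
    (pre p n)[i]? = if i < n then some (p i) else none := by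
  by_cases h : i < n <;> simp [pre, h]

theorem getD_pre {α : Type} (p : ℕ → α) (n i : ℕ) (d : α) :
    (pre p n).getD i d = if i < n then p i else d := by
  rw [List.getD_eq_getElem?_getD, getElem?_pre]
  split <;> rfl

theorem pre_congr {α : Type} {p q : ℕ → α} {n : ℕ} (h : ∀ i < n, p i = q i) :
    pre p n = pre q n := by
  apply List.map_congr_left
  intro i hi
  exact h i (List.mem_range.1 hi)

theorem pre_eq_iff {α : Type} {p q : ℕ → α} {n : ℕ} :
    pre p n = pre q n ↔ ∀ i < n, p i = q i := by
  refine ⟨fun h i hi => ?_, pre_congr⟩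
  have := congrArg (fun l => l[i]?) h
  simpa only [getElem?_pre, if_pos hi, Option.some.injEq] using this

theorem eq_pre_iff {α : Type} {l : List α} {p : ℕ → α} {n : ℕ} :
    l = pre p n ↔ l.length = n ∧ ∀ i < n, l[i]? = some (p i) := by
  constructor
  · rintro rfl
    exact ⟨length_pre _ _, fun i hi => by rw [getElem?_pre, if_pos hi]⟩
  · rintro ⟨hl, h⟩
    apply List.ext_getElem?
    intro i
    rw [getElem?_pre]
    split_ifs with hi
    · exact h i hi
    · exact List.getElem?_eq_none (by omega)

theorem pre_prefix {α : Type} (p : ℕ → α) {m n : ℕ} (h : m ≤ n) : pre p m <+: pre p n := by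
  rw [List.prefix_iff_getElem?]
  intro i hi
  rw [length_pre] at hi
  rw [getElem?_pre, if_pos (by omega)]
  simp [pre]

theorem pre_succ {α : Type} (p : ℕ → α) (n : ℕ) : pre p (n + 1) = pre p n ++ [p n] := by
  simp [pre, List.range_succ]

theorem prefix_pre_iff {α : Type} {l : List α} {p : ℕ → α} {n : ℕ} :
    l <+: pre p n ↔ l.length ≤ n ∧ l = pre p l.length := by
  constructor
  · intro h
    have hl : l.length ≤ n := by simpa using h.length_le
    refine ⟨hl, ?_⟩
    have := List.prefix_of_prefix_length_le h (pre_prefix p hl) (by simp)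
    exact this.eq_of_length (by simp)
  · rintro ⟨hl, h⟩
    rw [h]
    exact pre_prefix p hl

/-- A total function is computable if the `n`-th output entry depends only on the first
`c * (n + 1)` input entries and is a primitive recursive function of them. -/
theorem isComputable_of_modulus {f : Baire → Baire} {c : ℕ} (hc : 0 < c)
    (hf : Primrec₂ fun (u : List ℕ) (n : ℕ) => f (fun i => u.getD i 0) n)
    (hloc : ∀ p q n, (∀ i < c * (n + 1), p i = q i) → f p n = f q n) :
    IsComputable fun p => Part.some (f p) := by
  -- An output entry `k < u.length / c` reads only input positions below `c * (k + 1) ≤ u.length`,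
  -- so the padding of `u` by zeros is never read.
  refine ⟨fun u => pre (f fun i => u.getD i 0) (u.length / c), ?_, ?_, ?_⟩
  · have hdiv : Primrec fun u : List ℕ => u.length / c :=
      Primrec.nat_div.comp Primrec.list_length (Primrec.const c)
    exact (Primrec.list_map (Primrec.list_range.comp hdiv) hf).to_comp
  · rintro u _ ⟨v, rfl⟩
    rw [prefix_pre_iff, length_pre]
    refine ⟨Nat.div_le_div_right (by simp), pre_congr fun n hn => hloc _ _ _ fun i hi => ?_⟩
    have : i < u.length := lt_of_lt_of_le hi
      ((Nat.mul_le_mul_left c hn).trans (Nat.mul_div_le _ _))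
    simp [List.getElem?_append_left this]
  · intro p q hq
    obtain rfl := Part.mem_some_iff.1 hq
    refine ⟨fun n => ?_, fun m => ⟨c * m, ?_⟩⟩
    · simp only [length_pre]
      refine pre_congr fun k hk => hloc _ _ _ fun i hi => ?_
      have : i < n := lt_of_lt_of_le hi
        ((Nat.mul_le_mul_left c hk).trans (Nat.mul_div_le _ _))
      rw [getD_pre, if_pos this]
    · simp [Nat.mul_div_cancel_left _ hc]

theorem mem_bind_pfun {F : Baire →. Baire} {o : Part Baire} {q : Baire} :
    q ∈ o.bind F ↔ ∃ r ∈ o, q ∈ F r := Part.mem_bind_iff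

theorem IsComputable.comp {F G : Baire →. Baire} (hF : IsComputable F) (hG : IsComputable G) :
    IsComputable fun p => (G p).bind F := by
  obtain ⟨φ, hφ, hφm, hφF⟩ := hF
  obtain ⟨ψ, hψ, hψm, hψG⟩ := hG
  refine ⟨fun u => φ (ψ u), hφ.comp hψ, fun u v h => hφm _ _ (hψm _ _ h), ?_⟩
  intro p q hq
  obtain ⟨r, hr, hq⟩ := Part.mem_bind_iff.1 hq
  obtain ⟨h1, h2⟩ := hψG p r hr
  obtain ⟨h3, h4⟩ := hφF r q hq
  refine ⟨fun n => ?_, fun m => ?_⟩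
  · have := h3 (ψ (pre p n)).length
    rwa [← h1 n] at this
  · obtain ⟨a, ha⟩ := h4 m
    obtain ⟨n, hn⟩ := h2 a
    refine ⟨n, ha.trans (hφm _ _ ?_).length_le⟩
    rw [h1 n]
    exact pre_prefix r hn

/-- The alternating merge of two words, up to the length of the shorter one. -/
def interleave (u v : List ℕ) : List ℕ :=
  pre (pair (fun i => u.getD i 0) fun i => v.getD i 0) (2 * min u.length v.length)

theorem primrec_interleave : Primrec₂ interleave := by
  have hget : ∀ {g : (List ℕ × List ℕ) × ℕ → List ℕ}, Primrec g →
      Primrec fun x : (List ℕ × List ℕ) × ℕ => (g x).getD (x.2 / 2) 0 := fun hg =>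
    (Primrec.list_getD 0).comp hg (Primrec.nat_div.comp Primrec.snd (Primrec.const 2))
  refine Primrec.list_map (Primrec.list_range.comp ?_) ?_
  · exact Primrec.nat_mul.comp (Primrec.const 2) (Primrec.nat_min.comp
      (Primrec.list_length.comp Primrec.fst) (Primrec.list_length.comp Primrec.snd))
  · exact Primrec.ite (Primrec.eq.comp (Primrec.nat_mod.comp Primrec.snd (Primrec.const 2))
      (Primrec.const 0)) (hget (Primrec.fst.comp Primrec.fst)) (hget (Primrec.snd.comp Primrec.fst))

theorem IsComputable.pair {F G : Baire →. Baire} (hF : IsComputable F) (hG : IsComputable G) :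
    IsComputable fun p => (F p).bind fun a => (G p).bind fun b => Part.some (pair a b) := by
  obtain ⟨φ, hφ, hφm, hφF⟩ := hF
  obtain ⟨ψ, hψ, hψm, hψG⟩ := hG
  refine ⟨fun u => interleave (φ u) (ψ u), primrec_interleave.to_comp.comp hφ hψ, ?_, ?_⟩
  · intro u v h
    obtain ⟨s, hs⟩ := hφm _ _ h
    obtain ⟨t, ht⟩ := hψm _ _ h
    simp only [← hs, ← ht, interleave]
    rw [prefix_pre_iff, length_pre]
    refine ⟨by simp only [List.length_append]; omega, pre_congr fun i hi => ?_⟩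
    have h1 : i / 2 < (φ u).length := by omega
    have h2 : i / 2 < (ψ u).length := by omega
    simp [Weihrauch.pair, List.getElem?_append_left h1, List.getElem?_append_left h2]
  · intro p q hq
    obtain ⟨a, ha, hq⟩ := Part.mem_bind_iff.1 hq
    obtain ⟨b, hb, hq⟩ := Part.mem_bind_iff.1 hq
    obtain rfl := Part.mem_some_iff.1 hq
    obtain ⟨h1, h2⟩ := hφF p a ha
    obtain ⟨h3, h4⟩ := hψG p b hb
    refine ⟨fun n => ?_, fun m => ?_⟩
    · simp only [interleave, length_pre]
      refine pre_congr fun i hi => ?_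
      have e1 : i / 2 < (φ (pre p n)).length := by omega
      have e2 : i / 2 < (ψ (pre p n)).length := by omega
      have e3 : (φ (pre p n)).getD (i / 2) 0 = a (i / 2) := by
        rw [h1 n, getD_pre, if_pos e1]
      have e4 : (ψ (pre p n)).getD (i / 2) 0 = b (i / 2) := by
        rw [h3 n, getD_pre, if_pos e2]
      simp only [Weihrauch.pair, e3, e4]
    · obtain ⟨n1, hn1⟩ := h2 m
      obtain ⟨n2, hn2⟩ := h4 m
      refine ⟨max n1 n2, ?_⟩
      have e1 := (hφm _ _ (pre_prefix p (le_max_left n1 n2))).length_le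
      have e2 := (hψm _ _ (pre_prefix p (le_max_right n1 n2))).length_le
      simp only [interleave, length_pre]
      omega

theorem isComputable_evenPart : IsComputable fun p => Part.some (evenPart p) :=
  isComputable_of_modulus two_pos
    ((Primrec.list_getD 0).comp Primrec.fst
      (Primrec.nat_mul.comp (Primrec.const 2) Primrec.snd))
    fun _ _ _ h => h _ (by omega)

theorem isComputable_oddPart : IsComputable fun p => Part.some (oddPart p) :=
  isComputable_of_modulus two_pos
    ((Primrec.list_getD 0).comp Primrec.fst
      (Primrec.succ.comp (Primrec.nat_mul.comp (Primrec.const 2) Primrec.snd)))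
    fun _ _ _ h => h _ (by omega)

/-- A computable function is continuous. -/
theorem IsComputable.exists_modulus {F : Baire →. Baire} (hF : IsComputable F) {p q : Baire}
    (hq : q ∈ F p) (m : ℕ) :
    ∃ N, ∀ p' q', (∀ i < N, p' i = p i) → q' ∈ F p' → ∀ i < m, q' i = q i := by
  obtain ⟨φ, -, -, hφ⟩ := hF
  obtain ⟨h1, h2⟩ := hφ p q hq
  obtain ⟨N, hN⟩ := h2 m
  refine ⟨N, fun p' q' hp hq' i hi => ?_⟩
  have h3 := (hφ p' q' hq').1 N
  rw [pre_congr hp] at h3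
  exact pre_eq_iff.1 (h3.symm.trans (h1 N)) i (hi.trans_le hN)

/-! ### Transitivity of Weihrauch reducibility -/

/-- The outer witness of a composition of two Weihrauch reductions. -/
theorem IsComputable.comp_outer {H K K' : Baire →. Baire} (hH : IsComputable H)
    (hK : IsComputable K) (hK' : IsComputable K') :
    IsComputable fun t => (H (evenPart t)).bind fun r =>
      (K' (Weihrauch.pair r (oddPart t))).bind fun s => K (Weihrauch.pair (evenPart t) s) := by
  have h1 := hK'.comp ((hH.comp isComputable_evenPart).pair isComputable_oddPart)
  have h2 := hK.comp (isComputable_evenPart.pair h1)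
  refine Eq.mp (congrArg IsComputable (funext fun t => Part.ext fun q => ?_)) h2
  simp only [mem_bind_pfun, Part.mem_bind_iff, Part.mem_some_iff]
  constructor
  · rintro ⟨_, ⟨_, rfl, s, ⟨_, ⟨r, ⟨_, rfl, hr⟩, _, rfl, rfl⟩, hs⟩, rfl⟩, hq⟩
    exact ⟨r, hr, s, hs, hq⟩
  · rintro ⟨r, hr, s, hs, hq⟩
    exact ⟨_, ⟨_, rfl, s, ⟨_, ⟨r, ⟨_, rfl, hr⟩, _, rfl, rfl⟩, hs⟩, rfl⟩, hq⟩

/-- A realizer of `h` yields one of `g` through the second reduction, and this one is fed to the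
first. The inner witnesses compose; the outer witness has to recompute `H p`, because `K'` expects
the instance of `g` along with the answer. -/
theorem Reducible.trans {X Y Z W X' Y' : RepSpace} {f : MultiFun X Y} {g : MultiFun Z W}
    {h : MultiFun X' Y'} (hfg : Reducible f g) (hgh : Reducible g h) : Reducible f h := by
  obtain ⟨K, H, hK, hH, hfg⟩ := hfg
  obtain ⟨K', H', hK', hH', hgh⟩ := hgh
  refine ⟨_, _, hH.comp_outer hK hK', hH'.comp hH, fun G hG => ?_⟩
  have key := hfg _ (hgh G hG)
  refine Eq.mp (congrArg (Realizes · f) (funext fun p => ?_)) key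
  symm
  apply Part.ext
  intro q
  simp only [evenPart_pair, oddPart_pair, mem_bind_pfun, Part.mem_bind_iff]
  constructor
  · rintro ⟨r', ⟨r, hr, hr'⟩, s', hs', r2, hr2, s, hs, hq⟩
    obtain rfl := Part.mem_unique hr hr2
    exact ⟨r, hr, s, ⟨r', hr', s', hs', hs⟩, hq⟩
  · rintro ⟨r, hr, s, ⟨r', hr', s', hs', hs⟩, hq⟩
    exact ⟨r', ⟨r, hr, hr'⟩, s', hs', r, hr, s, hs, hq⟩

open MeasureTheory

/-! Martin-Löf tests -/

theorem PrimrecPred.exists_lt_param {α : Type} [Primcodable α] {R : α × ℕ → Prop}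
    (hR : PrimrecPred R) {m : α → ℕ} (hm : Primrec m) :
    PrimrecPred fun a => ∃ j < m a, R (a, j) := by
  have h : PrimrecRel fun (j : ℕ) (a : α) => R (a, j) :=
    hR.comp (Primrec.pair Primrec.snd Primrec.fst)
  refine (h.exists_mem_list.comp (Primrec.list_range.comp hm) Primrec.id).of_eq fun a => ?_
  simp

theorem PrimrecPred.forall_lt_param {α : Type} [Primcodable α] {R : α × ℕ → Prop}
    (hR : PrimrecPred R) {m : α → ℕ} (hm : Primrec m) :
    PrimrecPred fun a => ∀ j < m a, R (a, j) :=
  (PrimrecPred.exists_lt_param hR.not hm).not.of_eq fun a => by push Not; rfl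

/-- The cylinders of a computable sequence of open sets can be enumerated primitive
recursively. -/
theorem IsComputableOpenSeq.exists_primrec {U : ℕ → Set Cantor} (hU : IsComputableOpenSeq U) :
    ∃ w : ℕ → ℕ → Option (List Bool), Primrec₂ w ∧
      ∀ i, U i = {p | ∃ j, ∃ v ∈ w i j, p ∈ cylinder v} := by
  obtain ⟨w, hw, hUw⟩ := hU
  obtain ⟨c, hc⟩ := Nat.Partrec.Code.exists_code.1 hw
  have hev : ∀ i j, c.eval (Nat.pair i j) = Part.some (Encodable.encode (w i j)) := by
    intro i j
    rw [hc]
    simp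
  -- The index `n` codes a pair `(j, k)`: the word `w i j` is listed only if its computation
  -- succeeds within the bound `k`. The order of enumeration changes but the union does not.
  refine ⟨fun i n => (Nat.Partrec.Code.evaln n.unpair.2 c (Nat.pair i n.unpair.1)).bind fun e =>
    (Encodable.decode (α := Option (List Bool)) e).bind id, ?_, fun i => ?_⟩
  · refine Primrec.option_bind (Nat.Partrec.Code.primrec_evaln.comp
      (Primrec.pair (Primrec.pair ?_ (Primrec.const c)) ?_)) ?_
    · exact Primrec.snd.comp (Primrec.unpair.comp Primrec.snd)
    · exact Primrec₂.natPair.comp Primrec.fst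
        (Primrec.fst.comp (Primrec.unpair.comp Primrec.snd))
    · exact Primrec.option_bind (Primrec.decode.comp Primrec.snd) Primrec.snd
  · rw [hUw i]
    ext p
    constructor
    · rintro ⟨j, v, hv, hp⟩
      have h1 : Encodable.encode (w i j) ∈ c.eval (Nat.pair i j) := by
        rw [hev]
        exact Part.mem_some _
      obtain ⟨k, hk⟩ := Nat.Partrec.Code.evaln_complete.1 h1
      rw [Option.mem_def] at hk hv
      refine ⟨Nat.pair j k, v, ?_, hp⟩
      simp [hk, hv]
    · rintro ⟨n, v, hv, hp⟩
      rw [Option.mem_def, Option.bind_eq_some_iff] at hv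
      obtain ⟨e, he, hv⟩ := hv
      have h1 := Nat.Partrec.Code.evaln_sound he
      rw [hev, Part.mem_some_iff] at h1
      subst h1
      refine ⟨n.unpair.1, v, ?_, hp⟩
      simpa using hv

/-! ### The coin measure: cylinders and invariance under bit flips -/

theorem cylinder_eq_pi (w : List Bool) :
    cylinder w = Set.pi (Finset.range w.length) fun i => {w.getD i false} := by
  ext p
  change pre p w.length = w ↔ _
  rw [eq_comm, eq_pre_iff]
  simp only [true_and, Set.mem_pi, Finset.coe_range, Set.mem_Iio, Set.mem_singleton_iff]
  refine forall₂_congr fun i hi => ?_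
  simp [hi, eq_comm]

theorem measurableSet_cylinder (w : List Bool) : MeasurableSet (cylinder w) := by
  rw [cylinder_eq_pi]
  exact MeasurableSet.pi (Finset.countable_toSet _) fun _ _ => MeasurableSet.singleton _

theorem uniformBool_singleton (b : Bool) :
    (PMF.uniformOfFintype Bool).toMeasure {b} = (2⁻¹ : ENNReal) := by
  rw [PMF.toMeasure_apply_singleton _ _ (MeasurableSet.singleton _)]
  simp

theorem coinMeasure_cylinder (w : List Bool) :
    coinMeasure (cylinder w) = (2⁻¹ : ENNReal) ^ w.length := by
  rw [cylinder_eq_pi, coinMeasure, Measure.infinitePi_pi _ fun _ _ => MeasurableSet.singleton _]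
  simp

theorem IsComputableOpenSeq.measurableSet {U : ℕ → Set Cantor} (hU : IsComputableOpenSeq U)
    (i : ℕ) : MeasurableSet (U i) := by
  obtain ⟨w, -, h⟩ := hU
  have : U i = ⋃ j, ⋃ v ∈ {v | v ∈ w i j}, cylinder v := by
    rw [h]
    ext p
    simp
  rw [this]
  exact MeasurableSet.iUnion fun j => MeasurableSet.biUnion (Set.to_countable _)
    fun v _ => measurableSet_cylinder v

theorem map_xor_uniformBool (c : Bool) :
    (PMF.uniformOfFintype Bool).toMeasure.map (fun b => xor b c) =
      (PMF.uniformOfFintype Bool).toMeasure := by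
  refine Measure.ext_of_singleton fun b => ?_
  rw [Measure.map_apply (measurable_of_countable _) (MeasurableSet.singleton _)]
  have : (fun a => xor a c) ⁻¹' {b} = {xor b c} := by
    ext a
    cases a <;> cases b <;> cases c <;> simp
  rw [this, uniformBool_singleton, uniformBool_singleton]

/-- Flipping a bit preserves the uniform measure on each factor, hence the product measure. -/
theorem coinMeasure_preimage_xor (d : Cantor) {A : Set Cantor} (hA : MeasurableSet A) :
    coinMeasure ((fun p i => xor (p i) (d i)) ⁻¹' A) = coinMeasure A := by
  have h := Measure.infinitePi_map_pi (fun _ : ℕ => (PMF.uniformOfFintype Bool).toMeasure)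
    (f := fun i b => xor b (d i)) fun i => measurable_of_countable _
  simp only [map_xor_uniformBool] at h
  rw [coinMeasure]
  nth_rw 2 [← h]
  rw [Measure.map_apply _ hA]
  exact measurable_pi_lambda _ fun i =>
    (measurable_of_countable fun b => xor b (d i)).comp (measurable_pi_apply i)

/-- The bitwise sum of a word with the start of the word `l` (padded by zeros). -/
def xorWord (l v : List Bool) : List Bool :=
  (List.range v.length).map fun i => xor (v.getD i false) (l.getD i false)

theorem xor_mem_cylinder_iff (l v : List Bool) (p : Cantor) :
    (fun i => xor (p i) (l.getD i false)) ∈ cylinder v ↔ p ∈ cylinder (xorWord l v) := by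
  simp only [cylinder, Set.mem_ofPred_eq]
  rw [eq_comm, eq_pre_iff, eq_comm (b := xorWord l v), eq_pre_iff]
  simp only [xorWord, List.length_map, List.length_range, true_and]
  refine forall₂_congr fun i hi => ?_
  simp only [hi, List.getElem?_eq_getElem, List.getElem_map, List.getElem_range, List.length_map,
    List.length_range, Option.some.injEq, List.getD_eq_getElem?_getD, Option.getD_some]
  generalize v[i] = a
  generalize l[i]?.getD false = b
  cases p i <;> cases a <;> cases b <;> simp

/-- Randomness is preserved by finite modifications. -/
theorem IsUniversalMLTest.mem_randomSet_congr {U : ℕ → Set Cantor} (hU : IsUniversalMLTest U)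
    {x y : Cantor} (hx : x ∈ randomSet U) {N : ℕ} (h : ∀ n, N ≤ n → y n = x n) :
    y ∈ randomSet U := by
  obtain ⟨w, hw, hUw⟩ := hU.1.1.exists_primrec
  set l := pre (fun i => xor (x i) (y i)) N with hl
  set f : Cantor → Cantor := fun p i => xor (p i) (l.getD i false) with hf
  -- The preimage of the test under the finite bit flip exchanging `x` and `y` is again a test. If
  -- `y` were in all `U k`, then `x` would be in all components of this test.
  have hV : IsMLTest fun k => f ⁻¹' U k := by
    refine ⟨⟨fun i j => (w i j).map (xorWord l), ?_, fun i => ?_⟩, fun i => ?_⟩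
    · apply Primrec.to_comp
      refine Primrec.option_map hw ?_
      refine Primrec.list_map (Primrec.list_range.comp (Primrec.list_length.comp Primrec.snd)) ?_
      have hxor : Primrec₂ xor := Primrec.dom_finite _
      refine hxor.comp ((Primrec.list_getD false).comp
        (Primrec.snd.comp Primrec.fst) Primrec.snd) ?_
      exact (Primrec.list_getD false).comp (Primrec.const l) Primrec.snd
    · ext p
      simp only [hUw i, Set.preimage_ofPred_eq, Set.mem_ofPred_eq]
      constructor
      · rintro ⟨j, v, hv, hp⟩
        exact ⟨j, _, Option.mem_map_of_mem _ hv, (xor_mem_cylinder_iff l v p).1 hp⟩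
      · rintro ⟨j, v, hv, hp⟩
        obtain ⟨v', hv', rfl⟩ := Option.mem_map.1 hv
        exact ⟨j, v', hv', (xor_mem_cylinder_iff l v' p).2 hp⟩
    · rw [coinMeasure_preimage_xor _ (hU.1.1.measurableSet i)]
      exact hU.1.2 i
  have hfx : f x = y := by
    funext i
    simp only [hf, hl, getD_pre]
    split_ifs with hi
    · cases x i <;> cases y i <;> rfl
    · simp [h i (not_lt.1 hi)]
  intro hy
  refine hx (hU.2 _ hV (Set.mem_iInter.2 fun k => ?_))
  rw [Set.mem_preimage, hfx]
  exact Set.mem_iInter.1 hy k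

/-- A point with computable prefixes is contained in every component of a universal test. -/
theorem IsUniversalMLTest.mem_of_computable {U : ℕ → Set Cantor} (hU : IsUniversalMLTest U)
    {x : Cantor} {ψ : ℕ → List Bool} (hψ : Computable ψ)
    (hx : ∀ n, ψ n = pre x (ψ n).length) (hlen : ∀ m, ∃ n, m ≤ (ψ n).length) (i : ℕ) :
    x ∈ U i := by
  -- The test lists all known prefixes of `x` of length at least `i`; their cylinders lie in that of
  -- `pre x i`, which has measure `2⁻¹ ^ i`.
  set w : ℕ → ℕ → Option (List Bool) := fun i j => if i ≤ (ψ j).length then some (ψ j) else none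
    with hw
  have hV : IsMLTest fun i => {p | ∃ j, ∃ v ∈ w i j, p ∈ cylinder v} := by
    refine ⟨⟨w, ?_, fun i => rfl⟩, fun i => ?_⟩
    · have : Primrec₂ fun (i : ℕ) (v : List Bool) => if i ≤ v.length then some v else none :=
        Primrec.ite (Primrec.nat_le.comp Primrec.fst (Primrec.list_length.comp Primrec.snd))
          (Primrec.option_some.comp Primrec.snd) (Primrec.const none)
      exact this.to_comp.comp Computable.fst (hψ.comp Computable.snd)
    · refine (measure_mono (t := cylinder (pre x i)) ?_).trans_eq ?_
      · rintro p ⟨j, v, hv, hp⟩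
        simp only [hw, Option.mem_def, Option.ite_none_right_eq_some, Option.some.injEq] at hv
        obtain ⟨hi, rfl⟩ := hv
        change pre p _ = _ at hp
        rw [hx j, length_pre, pre_eq_iff] at hp
        change pre p _ = _
        rw [length_pre, pre_eq_iff]
        exact fun k hk => hp k (hk.trans_le hi)
      · rw [coinMeasure_cylinder, length_pre]
  refine Set.mem_iInter.1 (hU.2 _ hV (Set.mem_iInter.2 fun i => ?_)) i
  obtain ⟨n, hn⟩ := hlen i
  exact ⟨n, ψ n, by simp [hw, hn], (hx n).symm⟩

/-- Such a point is computable, its finitely many irregular bits being stored as a constant. This is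
what rules out that the merged sequence waits forever. -/
theorem IsUniversalMLTest.mem_of_eventually_false {U : ℕ → Set Cantor}
    (hU : IsUniversalMLTest U) {x : Cantor} {N : ℕ} (h : ∀ n, N ≤ n → x n = false) (i : ℕ) :
    x ∈ U i := by
  refine hU.mem_of_computable
    (ψ := fun n => (List.range n).map fun i => (pre x N).getD i false) ?_ ?_ ?_ i
  · exact (Primrec.list_map Primrec.list_range
      ((Primrec.list_getD false).comp (Primrec.const (pre x N)) Primrec.snd).to₂).to_comp
  · intro n
    simp only [List.length_map, List.length_range]
    refine pre_congr fun k _ => ?_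
    rw [getD_pre]
    split_ifs with hk
    · rfl
    · exact (h k (not_lt.1 hk)).symm
  · exact fun m => ⟨m, by simp⟩

/-- A random point is contained in only finitely many components of a universal test. -/
theorem IsUniversalMLTest.eventually_notMem {U : ℕ → Set Cantor} (hU : IsUniversalMLTest U)
    {x : Cantor} (hx : x ∈ randomSet U) : ∃ M, ∀ k, M ≤ k → x ∉ U k := by
  obtain ⟨w, hw, hUw⟩ := hU.1.1
  -- A Borel–Cantelli argument: the tails of the test form a test, and starting at `m + 1` makes the
  -- geometric series sum to `2⁻¹ ^ m`.
  have hV : IsMLTest fun m => ⋃ k, U (m + 1 + k) := by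
    refine ⟨⟨fun m j => w (m + 1 + j.unpair.1) j.unpair.2, ?_, fun m => ?_⟩, fun m => ?_⟩
    · have h1 : Primrec fun x : ℕ × ℕ => x.1 + 1 + x.2.unpair.1 :=
        Primrec.nat_add.comp (Primrec.succ.comp Primrec.fst)
          (Primrec.fst.comp (Primrec.unpair.comp Primrec.snd))
      have h2 : Primrec fun x : ℕ × ℕ => x.2.unpair.2 :=
        Primrec.snd.comp (Primrec.unpair.comp Primrec.snd)
      exact hw.comp h1.to_comp h2.to_comp
    · ext p
      simp only [hUw, Set.mem_iUnion, Set.mem_ofPred_eq]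
      constructor
      · rintro ⟨k, j, v, hv, hp⟩
        exact ⟨Nat.pair k j, v, by simpa using hv, hp⟩
      · rintro ⟨j, v, hv, hp⟩
        exact ⟨_, _, v, hv, hp⟩
    · calc coinMeasure (⋃ k, U (m + 1 + k)) ≤ ∑' k, coinMeasure (U (m + 1 + k)) :=
            measure_iUnion_le _
        _ ≤ ∑' k, (2⁻¹ : ENNReal) ^ (m + 1 + k) := ENNReal.tsum_le_tsum fun k => hU.1.2 _
        _ = (2⁻¹ : ENNReal) ^ m := by
            simp only [pow_add, pow_one]
            rw [ENNReal.tsum_mul_left, ENNReal.tsum_geometric, ENNReal.one_sub_inv_two, inv_inv,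
              mul_assoc, ENNReal.inv_mul_cancel two_ne_zero ENNReal.ofNat_ne_top, mul_one]
  by_contra! hM
  refine hx (hU.2 _ hV (Set.mem_iInter.2 fun m => ?_))
  obtain ⟨k, hk, hxk⟩ := hM (m + 1)
  exact Set.mem_iUnion.2 ⟨k - (m + 1), by rwa [Nat.add_sub_cancel' hk]⟩

/-! Names of points in product and coproduct spaces -/

theorem mem_cantor_rep {p : Baire} {x : Cantor} :
    x ∈ cantorSpace.rep p ↔ (∀ i, p i = 0 ∨ p i = 1) ∧ x = fun i => decide (p i = 1) :=
  ⟨fun ⟨h, e⟩ => ⟨h, e.symm⟩, fun ⟨h, e⟩ => ⟨h, e.symm⟩⟩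

theorem mem_prod_rep {X Y : RepSpace} {r : Baire} {z : X.Carrier × Y.Carrier} :
    z ∈ (X.prod Y).rep r ↔ z.1 ∈ X.rep (evenPart r) ∧ z.2 ∈ Y.rep (oddPart r) := by
  constructor
  · intro h
    obtain ⟨x, hx, h⟩ := Part.mem_bind_iff.1 h
    obtain ⟨y, hy, rfl⟩ := (Part.mem_map_iff _).1 h
    exact ⟨hx, hy⟩
  · rintro ⟨hx, hy⟩
    exact Part.mem_bind hx (Part.mem_map (fun y => (z.1, y)) hy)

theorem mem_sigma_rep {X : ℕ → RepSpace} {p : Baire} {z : Σ n, (X n).Carrier} :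
    z ∈ (RepSpace.sigma X).rep p ↔ ∃ x ∈ (X (p 0)).rep (tail p), z = ⟨p 0, x⟩ := by
  refine (Part.mem_map_iff _).trans ?_
  simp only [eq_comm]

theorem mk_mem_sigma_rep {X : ℕ → RepSpace} {p : Baire} {n : ℕ} {x : (X n).Carrier} :
    (⟨n, x⟩ : Σ n, (X n).Carrier) ∈ (RepSpace.sigma X).rep p ↔
      p 0 = n ∧ x ∈ (X n).rep (tail p) := by
  rw [mem_sigma_rep]
  constructor
  · rintro ⟨x', hx', e⟩
    cases e
    exact ⟨rfl, hx'⟩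
  · rintro ⟨rfl, hx⟩
    exact ⟨x, hx, rfl⟩

theorem inl_mem_sum_rep {X Y : RepSpace} {p : Baire} {x : X.Carrier} :
    (Sum.inl x : X.Carrier ⊕ Y.Carrier) ∈ (X.sum Y).rep p ↔ p 0 = 0 ∧ x ∈ X.rep (tail p) := by
  change _ ∈ (if p 0 = 0 then (X.rep (tail p)).map Sum.inl
    else if p 0 = 1 then (Y.rep (tail p)).map Sum.inr else Part.none) ↔ _
  split_ifs with h0 h1
  · exact (Part.mem_map_iff _).trans
      ⟨fun ⟨a, ha, e⟩ => ⟨h0, Sum.inl.inj e ▸ ha⟩, fun h => ⟨x, h.2, rfl⟩⟩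
  · exact (Part.mem_map_iff _).trans
      ⟨fun ⟨a, ha, e⟩ => (Sum.inr_ne_inl e).elim, fun h => (h0 h.1).elim⟩
  · exact ⟨fun h => (Part.notMem_none _ h).elim, fun h => (h0 h.1).elim⟩

theorem inr_mem_sum_rep {X Y : RepSpace} {p : Baire} {y : Y.Carrier} :
    (Sum.inr y : X.Carrier ⊕ Y.Carrier) ∈ (X.sum Y).rep p ↔ p 0 = 1 ∧ y ∈ Y.rep (tail p) := by
  change _ ∈ (if p 0 = 0 then (X.rep (tail p)).map Sum.inl
    else if p 0 = 1 then (Y.rep (tail p)).map Sum.inr else Part.none) ↔ _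
  split_ifs with h0 h1
  · exact (Part.mem_map_iff _).trans
      ⟨fun ⟨a, ha, e⟩ => (Sum.inl_ne_inr e).elim, fun h => by omega⟩
  · exact (Part.mem_map_iff _).trans
      ⟨fun ⟨a, ha, e⟩ => ⟨h1, Sum.inr.inj e ▸ ha⟩, fun h => ⟨y, h.2, rfl⟩⟩
  · exact ⟨fun h => (Part.notMem_none _ h).elim, fun h => (h1 h.1).elim⟩

/-! Finite stages of the enumeration of an open set -/

/-- The cylinder of `b` is contained in one of the first `n` cylinders enumerated by `w c`. -/
def CoveredBy (w : ℕ → ℕ → Option (List Bool)) (c n : ℕ) (b : List Bool) : Prop :=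
  ∃ j < n, (w c j).isSome ∧ (w c j).getD [] <+: b

theorem primrecPred_coveredBy {α : Type} [Primcodable α] {w : ℕ → ℕ → Option (List Bool)}
    (hw : Primrec₂ w) {c n : α → ℕ} {b : α → List Bool} (hc : Primrec c) (hn : Primrec n)
    (hb : Primrec b) : PrimrecPred fun a => CoveredBy w (c a) (n a) (b a) := by
  have hw' : Primrec fun x : α × ℕ => w (c x.1) x.2 :=
    hw.comp (hc.comp Primrec.fst) Primrec.snd
  have hv : Primrec fun x : α × ℕ => (w (c x.1) x.2).getD [] :=
    Primrec.option_getD.comp hw' (Primrec.const [])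
  have h1 : PrimrecPred fun x : α × ℕ => (w (c x.1) x.2).isSome = true :=
    Primrec.eq.comp (Primrec.option_isSome.comp hw') (Primrec.const true)
  have h2 : PrimrecPred fun x : α × ℕ => (w (c x.1) x.2).getD [] <+: b x.1 :=
    (Primrec.eq.comp hv (Primrec.list_take.comp (Primrec.list_length.comp hv)
      (hb.comp Primrec.fst))).of_eq fun x => List.prefix_iff_eq_take.symm
  exact PrimrecPred.exists_lt_param (h1.and h2) hn

theorem CoveredBy.mono {w : ℕ → ℕ → Option (List Bool)} {c n n' a a' : ℕ} {x : Cantor}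
    (h : CoveredBy w c n (pre x a)) (hn : n ≤ n') (ha : a ≤ a') :
    CoveredBy w c n' (pre x a') := by
  obtain ⟨j, hj, hs, hp⟩ := h
  exact ⟨j, hj.trans_le hn, hs, hp.trans (pre_prefix x ha)⟩

theorem CoveredBy.mem {U : ℕ → Set Cantor} {w : ℕ → ℕ → Option (List Bool)}
    (hU : ∀ i, U i = {p | ∃ j, ∃ v ∈ w i j, p ∈ cylinder v}) {c n a : ℕ} {x : Cantor}
    (h : CoveredBy w c n (pre x a)) : x ∈ U c := by
  obtain ⟨j, -, hs, hp⟩ := h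
  obtain ⟨v, hv⟩ := Option.isSome_iff_exists.1 hs
  rw [hv, Option.getD_some] at hp
  rw [hU]
  exact ⟨j, v, hv, (prefix_pre_iff.1 hp).2.symm⟩

theorem exists_coveredBy {U : ℕ → Set Cantor} {w : ℕ → ℕ → Option (List Bool)}
    (hU : ∀ i, U i = {p | ∃ j, ∃ v ∈ w i j, p ∈ cylinder v}) {c : ℕ} {x : Cantor}
    (h : x ∈ U c) : ∃ n, CoveredBy w c n (pre x n) := by
  rw [hU] at h
  obtain ⟨j, v, hv, hp⟩ := h
  rw [Option.mem_def] at hv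
  refine ⟨max (j + 1) v.length, j, by omega, by simp [hv], ?_⟩
  rw [hv, Option.getD_some, prefix_pre_iff]
  exact ⟨le_max_right _ _, hp.symm⟩

/-! Reductions -/

theorem layer_reducible_id_sum_layer (U : ℕ → Set Cantor) :
    Reducible (layer U) (idBaire.sum (layer U)) := by
  -- Here `t = pair p s`, so `t 3 = s 1`, the number that follows the tag in `s`.
  refine ⟨fun t => Part.some fun _ => t 3, fun p => Part.some (cons 1 p), ?_, ?_, ?_⟩
  · exact isComputable_of_modulus (c := 4) (by norm_num)
      ((Primrec.list_getD 0).comp Primrec.fst (Primrec.const 3)) fun _ _ _ h => h _ (by omega)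
  · refine isComputable_of_modulus (c := 1) (by norm_num) ?_ ?_
    · exact Primrec.nat_casesOn Primrec.snd (Primrec.const 1)
        ((Primrec.list_getD 0).comp (Primrec.fst.comp Primrec.fst) Primrec.snd)
    · rintro p q (_ | n) h
      · rfl
      · exact h n (by omega)
  · rintro G hG p x hx ⟨n, hn⟩
    obtain ⟨s, hs, y, hy, n', hn', rfl⟩ := hG (cons 1 p) (Sum.inr x)
      (inr_mem_sum_rep.2 ⟨rfl, hx⟩) ⟨Sum.inr n, n, hn, rfl⟩
    have hs1 := Part.mem_some_iff.1 (inr_mem_sum_rep.1 hy).2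
    refine ⟨fun _ => s 1, ?_, s 1, Part.mem_some _, ?_⟩
    · simp only [Part.bind_some, Part.mem_bind_iff]
      exact ⟨s, hs, Part.mem_some _⟩
    · change x ∉ U (s 1)
      rw [show s 1 = n' from hs1.symm]
      exact hn'

theorem id_sum_layer_reducible_star (U : ℕ → Set Cantor) :
    Reducible (idBaire.sum (layer U)) (layer U).star := by
  -- With tag `0`, `p` already names the instance `(0, tail p)` of the finite parallelization.
  -- Otherwise the instance has index `1` and a dummy zero sequence for the factor `X ^ 0`; the
  -- answer `s` has its tag at `0` and its layer at `2`, and `t 5 = s 2`.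
  refine ⟨fun t => Part.some (if t 0 = 0 then oddPart t else cons 1 fun _ => t 5),
    fun p => Part.some (if p 0 = 0 then p else cons 1 (pair (fun _ => 0) (tail p))), ?_, ?_, ?_⟩
  · refine isComputable_of_modulus (c := 6) (by norm_num) ?_ ?_
    · have h : Primrec fun x : List ℕ × ℕ => if x.1.getD 0 0 = 0 then x.1.getD (2 * x.2 + 1) 0
          else if x.2 = 0 then 1 else x.1.getD 5 0 := by
        refine Primrec.ite ?_ ?_ (Primrec.ite ?_ ?_ ?_)
        · exact Primrec.eq.comp ((Primrec.list_getD 0).comp Primrec.fst (Primrec.const 0))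
            (Primrec.const 0)
        · exact (Primrec.list_getD 0).comp Primrec.fst
            (Primrec.succ.comp (Primrec.nat_mul.comp (Primrec.const 2) Primrec.snd))
        · exact Primrec.eq.comp Primrec.snd (Primrec.const 0)
        · exact Primrec.const 1
        · exact (Primrec.list_getD 0).comp Primrec.fst (Primrec.const 5)
      refine h.of_eq fun x => ?_
      dsimp only
      split_ifs with h1 h2
      · rfl
      · rw [h2, cons_zero]
      · obtain ⟨n, hn⟩ := Nat.exists_eq_succ_of_ne_zero h2
        rw [hn]
        rfl
    · intro p q n h
      rw [h 0 (by omega), h 5 (by omega)]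
      split_ifs
      · exact h _ (by omega)
      · rfl
  · refine isComputable_of_modulus (c := 1) (by norm_num) ?_ ?_
    · have h : Primrec fun x : List ℕ × ℕ => if x.1.getD 0 0 = 0 then x.1.getD x.2 0
          else if x.2 = 0 then 1 else
            if (x.2 - 1) % 2 = 0 then 0 else x.1.getD ((x.2 - 1) / 2 + 1) 0 := by
        have hp : Primrec fun x : List ℕ × ℕ => x.2 - 1 := Primrec.pred.comp Primrec.snd
        refine Primrec.ite ?_ ?_ (Primrec.ite ?_ ?_ (Primrec.ite ?_ ?_ ?_))
        · exact Primrec.eq.comp ((Primrec.list_getD 0).comp Primrec.fst (Primrec.const 0))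
            (Primrec.const 0)
        · exact Primrec.list_getD 0
        · exact Primrec.eq.comp Primrec.snd (Primrec.const 0)
        · exact Primrec.const 1
        · exact Primrec.eq.comp (Primrec.nat_mod.comp hp (Primrec.const 2)) (Primrec.const 0)
        · exact Primrec.const 0
        · exact (Primrec.list_getD 0).comp Primrec.fst
            (Primrec.succ.comp (Primrec.nat_div.comp hp (Primrec.const 2)))
      refine h.of_eq fun x => ?_
      dsimp only
      by_cases h1 : x.1.getD 0 0 = 0
      · rw [if_pos h1, if_pos h1]
      · rw [if_neg h1, if_neg h1]
        by_cases h2 : x.2 = 0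
        · rw [if_pos h2, h2, cons_zero]
        · obtain ⟨n, hn⟩ := Nat.exists_eq_succ_of_ne_zero h2
          rw [if_neg h2, hn]
          rfl
    · intro p q n h
      rw [h 0 (by omega)]
      split_ifs
      · exact h _ (by omega)
      · cases n with
        | zero => rfl
        | succ n =>
          change pair (fun _ => 0) (tail p) n = pair (fun _ => 0) (tail q) n
          unfold pair tail
          split_ifs
          · rfl
          · exact h _ (by omega)
  · rintro G hG p x hx hdom
    cases x with
    | inl x =>
      obtain ⟨h0, hx⟩ := inl_mem_sum_rep.1 hx
      obtain ⟨s, hs, y, hy, x', hx', he⟩ := hG p ⟨0, x⟩ (mk_mem_sigma_rep.2 ⟨h0, hx⟩)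
        ⟨_, x, rfl, rfl⟩
      rw [← he] at hy
      obtain ⟨hs0, hy'⟩ := mk_mem_sigma_rep.1 hy
      have hys : tail s = x := (Part.mem_some_iff.1 hy').symm.trans hx'
      refine ⟨s, ?_, Sum.inl (tail s), inl_mem_sum_rep.2 ⟨hs0, Part.mem_some _⟩, _, ?_, rfl⟩
      · simp only [Part.bind_some, Part.mem_bind_iff, if_pos h0]
        refine ⟨s, hs, ?_⟩
        have : pair p s 0 = p 0 := rfl
        rw [this, if_pos h0, oddPart_pair]
        exact Part.mem_some _
      · exact hys
    | inr x =>
      obtain ⟨h1, hx⟩ := inr_mem_sum_rep.1 hx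
      obtain ⟨_, n, hn, -⟩ := hdom
      have h0 : p 0 ≠ 0 := by omega
      obtain ⟨s, hs, y, hy, x', hx', rfl⟩ := hG (cons 1 (pair (fun _ => 0) (tail p)))
        ⟨1, (fun _ => 0, x)⟩ (mk_mem_sigma_rep (X := cantorSpace.pow).2 ⟨rfl,
          mem_prod_rep.2 ⟨by rw [tail_cons, evenPart_pair]; exact Part.mem_some _,
            by rw [tail_cons, oddPart_pair]; exact hx⟩⟩)
        ⟨_, (fun _ => 0, n), ⟨rfl, hn⟩, rfl⟩
      obtain ⟨hs0, hy'⟩ := mk_mem_sigma_rep.1 hy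
      have hys : x'.2 = s 2 := Part.mem_some_iff.1 (mem_prod_rep.1 hy').2
      refine ⟨cons 1 fun _ => s 2, ?_, Sum.inr (s 2),
        inr_mem_sum_rep.2 ⟨rfl, Part.mem_some _⟩, s 2, ?_, rfl⟩
      · simp only [Part.bind_some, Part.mem_bind_iff, if_neg h0]
        refine ⟨s, hs, ?_⟩
        have : pair p s 0 = p 0 := rfl
        rw [this, if_neg h0]
        exact Part.mem_some _
      · rw [← hys]
        exact hx'.2

open scoped Classical in
/-- A name of the set of all `k` with `x ∉ U k`, where `w` enumerates `U` and `tail p` is a name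
of `x`; a name of `ℕ` if `p 0 = 0`. -/
def layerName (w : ℕ → ℕ → Option (List Bool)) (p : Baire) : Baire := fun n =>
  if p 0 ≠ 0 ∧ CoveredBy w n.unpair.1 n (pre (fun i => decide (p (i + 1) = 1)) n)
    then n.unpair.1 + 1 else 0

theorem isComputable_layerName {w : ℕ → ℕ → Option (List Bool)} (hw : Primrec₂ w) :
    IsComputable fun p => Part.some (layerName w p) := by
  classical
  refine isComputable_of_modulus (c := 1) (by norm_num) ?_ ?_
  · have hk : Primrec fun x : List ℕ × ℕ => x.2.unpair.1 :=
      Primrec.fst.comp (Primrec.unpair.comp Primrec.snd)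
    refine Primrec.ite (PrimrecPred.and (PrimrecPred.not ?_)
      (primrecPred_coveredBy hw hk Primrec.snd ?_)) (Primrec.succ.comp hk) (Primrec.const 0)
    · exact Primrec.eq.comp ((Primrec.list_getD 0).comp Primrec.fst (Primrec.const 0))
        (Primrec.const 0)
    · refine Primrec.list_map (Primrec.list_range.comp Primrec.snd) ?_
      exact PrimrecPred.decide (Primrec.eq.comp ((Primrec.list_getD 0).comp
        (Primrec.fst.comp Primrec.fst) (Primrec.succ.comp Primrec.snd)) (Primrec.const 1))
  · intro p q n h
    have h1 : pre (fun i => decide (p (i + 1) = 1)) n = pre (fun i => decide (q (i + 1) = 1)) n :=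
      pre_congr fun i hi => by rw [h (i + 1) (by omega)]
    simp only [layerName, h 0 (by omega : 0 < 1 * (n + 1)), h1]

theorem id_sum_layer_reducible_choiceNat {U : ℕ → Set Cantor} (hU : IsComputableOpenSeq U) :
    Reducible (idBaire.sum (layer U)) choiceNat := by
  obtain ⟨w, hw, hUw⟩ := hU.exists_primrec
  -- With tag `0` the input `p` is its own answer, and closed choice is applied to `ℕ` only so that
  -- some answer exists. Otherwise `t 1 = s 0` is the chosen number.
  refine ⟨fun t => Part.some (if t 0 = 0 then evenPart t else cons 1 fun _ => t 1),
    fun p => Part.some (layerName w p), ?_, isComputable_layerName hw, ?_⟩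
  · refine isComputable_of_modulus (c := 2) (by norm_num) ?_ ?_
    · have h : Primrec fun x : List ℕ × ℕ => if x.1.getD 0 0 = 0 then x.1.getD (2 * x.2) 0
          else if x.2 = 0 then 1 else x.1.getD 1 0 := by
        refine Primrec.ite ?_ ?_ (Primrec.ite ?_ ?_ ?_)
        · exact Primrec.eq.comp ((Primrec.list_getD 0).comp Primrec.fst (Primrec.const 0))
            (Primrec.const 0)
        · exact (Primrec.list_getD 0).comp Primrec.fst
            (Primrec.nat_mul.comp (Primrec.const 2) Primrec.snd)
        · exact Primrec.eq.comp Primrec.snd (Primrec.const 0)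
        · exact Primrec.const 1
        · exact (Primrec.list_getD 0).comp Primrec.fst (Primrec.const 1)
      refine h.of_eq fun x => ?_
      dsimp only
      split_ifs with h1 h2
      · rfl
      · rw [h2, cons_zero]
      · obtain ⟨n, hn⟩ := Nat.exists_eq_succ_of_ne_zero h2
        rw [hn]
        rfl
    · intro p q n h
      rw [h 0 (by omega), h 1 (by omega)]
      split_ifs
      · exact h _ (by omega)
      · rfl
  · rintro G hG p x hx hdom
    cases x with
    | inl x =>
      obtain ⟨h0, hx⟩ := inl_mem_sum_rep.1 hx
      obtain ⟨s, hs, -⟩ := hG (layerName w p) _ (Part.mem_some _) ⟨0, by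
        rintro ⟨i, hi⟩
        simp [layerName, h0] at hi⟩
      refine ⟨p, ?_, Sum.inl x, inl_mem_sum_rep.2 ⟨h0, hx⟩, x, rfl, rfl⟩
      simp only [Part.bind_some, Part.mem_bind_iff]
      refine ⟨s, hs, ?_⟩
      have : pair p s 0 = p 0 := rfl
      rw [this, if_pos h0, evenPart_pair]
      exact Part.mem_some _
    | inr x =>
      obtain ⟨h1, hx⟩ := inr_mem_sum_rep.1 hx
      obtain ⟨-, rfl⟩ := mem_cantor_rep.1 hx
      obtain ⟨_, n, hn, -⟩ := hdom
      have h0 : p 0 ≠ 0 := by omega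
      set x : Cantor := fun i => decide (tail p i = 1) with hxdef
      have key : ∀ k, (¬ ∃ n, layerName w p n = k + 1) ↔ x ∉ U k := by
        intro k
        unfold layerName
        rw [not_iff_not]
        constructor
        · rintro ⟨n, hn⟩
          split_ifs at hn with h
          obtain rfl : n.unpair.1 = k := by omega
          exact CoveredBy.mem hUw h.2
        · intro hk
          obtain ⟨n, hn⟩ := exists_coveredBy hUw hk
          -- Position `Nat.pair k n` tests `k` at a stage at least `n`, where the covering is still
          -- visible.
          refine ⟨Nat.pair k n, ?_⟩
          rw [if_pos, Nat.unpair_pair]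
          rw [Nat.unpair_pair]
          exact ⟨h0, hn.mono (Nat.right_le_pair k n) (Nat.right_le_pair k n)⟩
      obtain ⟨s, hs, y, hy, hyA⟩ := hG (layerName w p) _ (Part.mem_some _) ⟨n, (key n).2 hn⟩
      obtain rfl := Part.mem_some_iff.1 hy
      refine ⟨cons 1 fun _ => s 0, ?_, Sum.inr (s 0),
        inr_mem_sum_rep.2 ⟨rfl, Part.mem_some _⟩, s 0, (key _).1 hyA, rfl⟩
      simp only [Part.bind_some, Part.mem_bind_iff]
      refine ⟨s, hs, ?_⟩
      have : pair p s 0 = p 0 := rfl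
      rw [this, if_neg h0]
      exact Part.mem_some _

/-! Non-reductions -/

/-- A realizer may behave arbitrarily off the names of points of the domain. One that is undefined
there forces the inner witness of a reduction to produce names of genuine instances. -/
theorem exists_realizer {X Y : RepSpace} (f : MultiFun X Y) :
    ∃ G : Baire →. Baire, Realizes G f ∧
      ∀ p q, q ∈ G p → ∃ x ∈ X.rep p, x ∈ f.dom := by
  have h : ∀ p, (∃ x ∈ X.rep p, x ∈ f.dom) →
      ∃ q, ∀ x ∈ X.rep p, ∃ y ∈ Y.rep q, y ∈ f x := by
    rintro p ⟨x, hx, y, hy⟩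
    obtain ⟨q, hq⟩ := Y.surj y
    refine ⟨q, fun x' hx' => ?_⟩
    rw [Part.mem_unique hx' hx]
    exact ⟨y, hq, hy⟩
  choose g hg using h
  refine ⟨fun p => ⟨∃ x ∈ X.rep p, x ∈ f.dom, g p⟩, fun p x hx hdom => ?_, ?_⟩
  · exact ⟨g p ⟨x, hx, hdom⟩, ⟨⟨x, hx, hdom⟩, rfl⟩, hg p _ x hx⟩
  · rintro p q ⟨hp, -⟩
    exact hp

/-- The image of a computable point under a computable function does not name a random
point, not even after removing finitely many entries. -/
theorem IsUniversalMLTest.notMem_randomSet_of_isComputable {U : ℕ → Set Cantor}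
    (hU : IsUniversalMLTest U) {F : Baire →. Baire} (hF : IsComputable F) {q : Baire}
    (hq : q ∈ F fun _ => 0) (d : ℕ) : (fun i => decide (q (i + d) = 1)) ∉ randomSet U := by
  obtain ⟨φ, hφ, -, h⟩ := hF
  obtain ⟨h1, h2⟩ := h _ q hq
  rw [randomSet, Set.notMem_compl_iff, Set.mem_iInter]
  refine hU.mem_of_computable (ψ := fun n =>
    (List.range ((φ (pre (fun _ => 0) n)).length - d)).map fun i =>
      decide ((φ (pre (fun _ => 0) n)).getD (i + d) 0 = 1)) ?_ (fun n => ?_) fun m => ?_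
  · have hpre : Primrec fun n => pre (fun _ => 0) n :=
      Primrec.list_map Primrec.list_range (Primrec.const 0).to₂
    have hbits : Primrec fun u : List ℕ =>
        (List.range (u.length - d)).map fun i => decide (u.getD (i + d) 0 = 1) := by
      refine Primrec.list_map (Primrec.list_range.comp
        (Primrec.nat_sub.comp Primrec.list_length (Primrec.const d))) ?_
      exact PrimrecPred.decide (Primrec.eq.comp ((Primrec.list_getD 0).comp Primrec.fst
        (Primrec.nat_add.comp Primrec.snd (Primrec.const d))) (Primrec.const 1))
    exact hbits.to_comp.comp (hφ.comp hpre.to_comp)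
  · simp only [List.length_map, List.length_range]
    refine pre_congr fun i hi => ?_
    have : (φ (pre (fun _ => 0) n)).getD (i + d) 0 = q (i + d) := by
      rw [h1 n, getD_pre, if_pos (by omega)]
    rw [this]
  · obtain ⟨n, hn⟩ := h2 (m + d)
    refine ⟨n, ?_⟩
    simp only [List.length_map, List.length_range]
    omega

/-- The computable instance `(0, 000…)` would be mapped by `H` to a computable name of a random
sequence. -/
theorem IsUniversalMLTest.not_star_reducible_layer {U : ℕ → Set Cantor}
    (hU : IsUniversalMLTest U) : ¬ Reducible (layer U).star (layer U) := by
  rintro ⟨K, H, -, hH, h⟩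
  obtain ⟨G, hG, hGdom⟩ := exists_realizer (layer U)
  obtain ⟨q, hq, -⟩ := h G hG (fun _ => 0) ⟨0, fun _ => 0⟩
    (mk_mem_sigma_rep (X := cantorSpace.pow).2 ⟨rfl, Part.mem_some _⟩) ⟨_, fun _ => 0, rfl, rfl⟩
  obtain ⟨r, hr, hq⟩ := Part.mem_bind_iff.1 hq
  obtain ⟨s, hs, -⟩ := Part.mem_bind_iff.1 hq
  obtain ⟨x, hx, hdom⟩ := hGdom r s hs
  obtain ⟨-, rfl⟩ := mem_cantor_rep.1 hx
  rw [dom_layer] at hdom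
  exact hU.notMem_randomSet_of_isComputable hH hr 0 hdom

open scoped Classical in
theorem IsUniversalMLTest.not_choiceNat_reducible {U : ℕ → Set Cantor}
    (hU : IsUniversalMLTest U) : ¬ Reducible choiceNat (idBaire.sum (layer U)) := by
  rintro ⟨K, H, hK, hH, h⟩
  obtain ⟨G, hG, hGdom⟩ := exists_realizer (idBaire.sum (layer U))
  -- On the identity side the realizer is fixed to be the identity, so that the composite is
  -- continuous there.
  set G' : Baire →. Baire := fun p => if p 0 = 0 then Part.some p else G p with hG'
  have hG'r : Realizes G' (idBaire.sum (layer U)) := by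
    intro p x hx hdom
    by_cases h0 : p 0 = 0
    · cases x with
      | inl x =>
        exact ⟨p, by simp [hG', h0], Sum.inl x, inl_mem_sum_rep.2 (inl_mem_sum_rep.1 hx),
          x, rfl, rfl⟩
      | inr x =>
        have := (inr_mem_sum_rep.1 hx).1
        omega
    · have : G' p = G p := if_neg h0
      rw [this]
      exact hG p x hx hdom
  set z : Baire := fun _ => 0 with hz
  obtain ⟨q, hq, -⟩ := h G' hG'r z _ (Part.mem_some _) ⟨0, by
    rintro ⟨i, hi⟩
    simp [hz] at hi⟩
  obtain ⟨r, hr, hq⟩ := Part.mem_bind_iff.1 hq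
  obtain ⟨s, hs, hqK⟩ := Part.mem_bind_iff.1 hq
  -- Tag `1` would make the rest of `r` a computable random sequence.
  have hr0 : r 0 = 0 := by
    by_contra hr0
    have : G' r = G r := if_neg hr0
    rw [this] at hs
    obtain ⟨x, hx, hdom⟩ := hGdom r s hs
    cases x with
    | inl x => exact hr0 (inl_mem_sum_rep.1 hx).1
    | inr x =>
      obtain ⟨-, hx⟩ := inr_mem_sum_rep.1 hx
      obtain ⟨-, rfl⟩ := mem_cantor_rep.1 hx
      obtain ⟨_, n, hn, -⟩ := hdom
      refine hU.notMem_randomSet_of_isComputable hH hr 1 ?_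
      rw [← dom_layer]
      exact ⟨n, hn⟩
  have hG'0 : ∀ {r s : Baire}, r 0 = 0 → s ∈ G' r → s = r := by
    intro r s hr hs
    have : G' r = Part.some r := if_pos hr
    rw [this] at hs
    exact Part.mem_some_iff.1 hs
  obtain rfl := hG'0 hr0 hs
  obtain ⟨a, ha⟩ := hK.exists_modulus hqK 1
  -- The first `a` entries of `pair z r` use fewer than `a + 1` entries of `r`; the extra one
  -- secures the tag `r 0` even if `a = 0`.
  obtain ⟨b, hb⟩ := hH.exists_modulus hr (a + 1)
  -- The answer `q 0` is excluded only at position `a + b`, beyond everything that the answer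
  -- depends on.
  set z' : Baire := fun i => if i = a + b then q 0 + 1 else 0 with hz'
  have hzz : ∀ i < a + b, z' i = z i := fun i hi => if_neg hi.ne
  obtain ⟨q', hq', y, hy, hyA⟩ := h G' hG'r z' _ (Part.mem_some _) ⟨q 0 + 1, by
    rintro ⟨i, hi⟩
    simp only [hz'] at hi
    split_ifs at hi
    omega⟩
  obtain ⟨r', hr', hq'⟩ := Part.mem_bind_iff.1 hq'
  obtain ⟨s', hs', hqK'⟩ := Part.mem_bind_iff.1 hq'
  have hrr := hb z' r' (fun i hi => hzz i (by omega)) hr'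
  obtain rfl := hG'0 ((hrr 0 (by omega)).trans hr0) hs'
  have hqq : q' 0 = q 0 := by
    refine ha _ q' (fun i hi => ?_) hqK' 0 one_pos
    unfold pair
    split_ifs
    · exact hzz _ (by omega)
    · exact hrr _ (by omega)
  obtain rfl := Part.mem_some_iff.1 hy
  exact hyA ⟨a + b, by simp [hz', hqq]⟩

/-! Reducing finitely many layer problems to a single one -/

/-- The part of a name of a point of `X ^ m` that names its `k`-th entry, counted from the
right. -/
def component (k : ℕ) (r : Baire) : Baire := oddPart (evenPart^[k] r)

theorem iterate_evenPart_apply (k : ℕ) (r : Baire) (i : ℕ) : evenPart^[k] r i = r (2 ^ k * i) := by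
  induction k generalizing r with
  | zero => simp
  | succ k ih =>
    rw [Function.iterate_succ_apply, ih, evenPart, pow_succ']
    ring_nf

theorem component_apply (k : ℕ) (r : Baire) (i : ℕ) :
    component k r i = r (2 ^ k * (2 * i + 1)) := by
  rw [component, oddPart, iterate_evenPart_apply]

theorem component_mem_of_mem_dom {U : ℕ → Set Cantor} {m : ℕ} {r : Baire}
    {x : (cantorSpace.pow m).Carrier} (hx : x ∈ (cantorSpace.pow m).rep r)
    (hdom : x ∈ ((layer U).pow m).dom) {k : ℕ} (hk : k < m) :
    ∃ z ∈ cantorSpace.rep (component k r), z ∈ randomSet U := by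
  induction m generalizing r k with
  | zero => omega
  | succ m ih =>
    obtain ⟨h1, h2⟩ := mem_prod_rep.1 hx
    obtain ⟨y, hy1, hy2⟩ := hdom
    cases k with
    | zero =>
      refine ⟨x.2, h2, ?_⟩
      rw [← dom_layer]
      exact ⟨y.2, hy2⟩
    | succ k => exact ih h1 ⟨y.1, hy1⟩ (by omega)

/-- A solution must reproduce the factor `X ^ 0` exactly, as the zeroth power is the identity, while
in every other component only the first entry matters. -/
theorem exists_mem_pow_layer {U : ℕ → Set Cantor} {m : ℕ} {r t : Baire}
    {x : (cantorSpace.pow m).Carrier} (hx : x ∈ (cantorSpace.pow m).rep r)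
    (ht : evenPart^[m] t = evenPart^[m] r)
    (h : ∀ k < m, ∀ z ∈ cantorSpace.rep (component k r), z ∉ U (component k t 0)) :
    ∃ y ∈ (natSpace.pow m).rep t, y ∈ (layer U).pow m x := by
  induction m generalizing r t with
  | zero =>
    have ht' : t = r := ht
    subst ht'
    exact ⟨t, Part.mem_some _, (Part.mem_some_iff.1 hx).symm⟩
  | succ m ih =>
    obtain ⟨h1, h2⟩ := mem_prod_rep.1 hx
    obtain ⟨y, hy, hyx⟩ := ih h1 ht fun k hk z hz => h (k + 1) (by omega) z hz
    exact ⟨(y, component 0 t 0), mem_prod_rep.2 ⟨hy, Part.mem_some _⟩, hyx,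
      h 0 (by omega) _ h2⟩

/-- The start of the `k`-th entry of the tuple named by `tail p` that is visible at stage `n`. -/
def componentBits (p : Baire) (k n : ℕ) : List Bool :=
  -- Bit `i` of component `k` sits at position `2 ^ k * (2 * i + 1) + 1 ≤ (i + 1) * 2 ^ (k + 1)` of
  -- `p`, so this length uses no entry of `p` beyond `n`.
  pre (fun i => decide (component k (tail p) i = 1)) (n / 2 ^ (k + 1))

/-- At stage `n`, every component of the test that is seen to contain an entry of the tuple also
is seen to contain the cylinder of `o`. -/
def Absorbs (w : ℕ → ℕ → Option (List Bool)) (p : Baire) (n : ℕ) (o : List Bool) : Prop :=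
  ∀ c < n, ∀ k < p 0, CoveredBy w c n (componentBits p k n) → CoveredBy w c n o

open scoped Classical in
/-- The next bit of the combined sequence: a bit of the last entry of the tuple, or zero as long
as the sequence still has to be moved into some component of the test. -/
def mergeBit (w : ℕ → ℕ → Option (List Bool)) (p : Baire) (n : ℕ) (o : List Bool) : Bool :=
  -- Entry `2 * n + 2` of `p` is bit `n` of component `0`: copying resumes at the current position,
  -- not where it was interrupted, so that only finitely many bits are altered.
  if Absorbs w p n o then decide (p (2 * n + 2) = 1) else false

/-- The first `n` bits of the combined sequence. -/
def mergeWord (w : ℕ → ℕ → Option (List Bool)) (p : Baire) (n : ℕ) : List Bool :=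
  Nat.rec [] (fun n o => o ++ [mergeBit w p n o]) n

/-- A sequence that is in every component of the test that contains an entry of the tuple named
by `tail p`, and that eventually agrees with the last entry if all entries are random. -/
def mergeSeq (w : ℕ → ℕ → Option (List Bool)) (p : Baire) : Cantor :=
  fun n => mergeBit w p n (mergeWord w p n)

theorem mergeWord_succ (w : ℕ → ℕ → Option (List Bool)) (p : Baire) (n : ℕ) :
    mergeWord w p (n + 1) = mergeWord w p n ++ [mergeBit w p n (mergeWord w p n)] := rfl

theorem mergeWord_eq_pre (w : ℕ → ℕ → Option (List Bool)) (p : Baire) (n : ℕ) :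
    mergeWord w p n = pre (mergeSeq w p) n := by
  induction n with
  | zero => rfl
  | succ n ih => rw [pre_succ, ← ih, mergeWord_succ, mergeSeq]

/-- Otherwise `U c` blocks copying forever once the entry has been seen in it. The sequence is then
eventually zero, hence computable, and so lies in `U c` after all. Randomness of the entries plays
no role. -/
theorem mergeSeq_mem {U : ℕ → Set Cantor} (hU : IsUniversalMLTest U)
    {w : ℕ → ℕ → Option (List Bool)}
    (hUw : ∀ i, U i = {p | ∃ j, ∃ v ∈ w i j, p ∈ cylinder v}) {p : Baire} {k c : ℕ}
    (hk : k < p 0) (hc : (fun i => decide (component k (tail p) i = 1)) ∈ U c) :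
    mergeSeq w p ∈ U c := by
  by_contra hq
  obtain ⟨a, ha⟩ := exists_coveredBy hUw hc
  -- From this stage on `c` is among the inspected indices and at least `a` bits of the entry are
  -- visible.
  refine hq (hU.mem_of_eventually_false (N := max (c + 1) (a * 2 ^ (k + 1))) (fun n hn => ?_) c)
  have h1 : a ≤ n / 2 ^ (k + 1) :=
    (Nat.le_div_iff_mul_le (by positivity)).2 ((le_max_right _ _).trans hn)
  have h2 : a ≤ n := h1.trans (Nat.div_le_self _ _)
  refine if_neg fun hab => hq ?_
  have := hab c ((le_max_left _ _).trans hn) k hk (ha.mono h2 h1)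
  rw [mergeWord_eq_pre] at this
  exact this.mem hUw

/-- Only finitely many `U c` contain an entry, and by `mergeSeq_mem` each of them is eventually seen
to contain the merged sequence. From then on the last entry is copied. -/
theorem mergeSeq_mem_randomSet {U : ℕ → Set Cantor} (hU : IsUniversalMLTest U)
    {w : ℕ → ℕ → Option (List Bool)}
    (hUw : ∀ i, U i = {p | ∃ j, ∃ v ∈ w i j, p ∈ cylinder v}) {p : Baire} (hp : 0 < p 0)
    (hrand : ∀ k < p 0, (fun i => decide (component k (tail p) i = 1)) ∈ randomSet U) :
    mergeSeq w p ∈ randomSet U := by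
  have h1 : ∀ k, ∃ M, k < p 0 → ∀ c, M ≤ c →
      (fun i => decide (component k (tail p) i = 1)) ∉ U c := by
    intro k
    by_cases hk : k < p 0
    · obtain ⟨M, hM⟩ := hU.eventually_notMem (hrand k hk)
      exact ⟨M, fun _ => hM⟩
    · exact ⟨0, fun h => (hk h).elim⟩
  choose M hM using h1
  -- Each single `c` stops blocking: either the merged sequence is in `U c` and this becomes
  -- visible, or no entry is in `U c`.
  have h2 : ∀ c, ∃ N, ∀ n, N ≤ n → ∀ k < p 0, CoveredBy w c n (componentBits p k n) →
      CoveredBy w c n (mergeWord w p n) := by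
    intro c
    by_cases hc : mergeSeq w p ∈ U c
    · obtain ⟨N, hN⟩ := exists_coveredBy hUw hc
      refine ⟨N, fun n hn k _ _ => ?_⟩
      rw [mergeWord_eq_pre]
      exact hN.mono hn hn
    · exact ⟨0, fun n _ k hk h => (hc (mergeSeq_mem hU hUw hk (h.mem hUw))).elim⟩
  choose N hN using h2
  refine hU.mem_randomSet_congr (hrand 0 hp)
    (N := (Finset.range ((Finset.range (p 0)).sup M)).sup N) fun n hn => ?_
  have hab : Absorbs w p n (mergeWord w p n) := by
    intro c _ k hk h
    by_cases hc : c < (Finset.range (p 0)).sup M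
    · exact hN c n ((Finset.le_sup (Finset.mem_range.2 hc)).trans hn) k hk h
    · exact (hM k hk c ((Finset.le_sup (Finset.mem_range.2 hk)).trans (not_lt.1 hc))
        (h.mem hUw)).elim
  refine (if_pos hab).trans ?_
  rw [component_apply, tail, show 2 ^ 0 * (2 * n + 1) + 1 = 2 * n + 2 by ring]

/-! ### Computability of the merged instance and recovery of the solutions -/

/-- A name of an instance of `id + layer` for an instance of the finite parallelization. -/
def mergeName (w : ℕ → ℕ → Option (List Bool)) (p : Baire) : Baire :=
  cons (min (p 0) 1) fun n => (mergeSeq w p n).toNat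

theorem componentBits_congr {p q : Baire} {n k : ℕ} (h : ∀ i ≤ n, p i = q i) :
    componentBits p k n = componentBits q k n := by
  refine pre_congr fun i hi => ?_
  have h1 : (i + 1) * 2 ^ (k + 1) ≤ n := (Nat.le_div_iff_mul_le (by positivity)).1 hi
  have h2 : (i + 1) * 2 ^ (k + 1) = 2 ^ k * (2 * i + 1) + 2 ^ k := by ring
  have h3 : 0 < 2 ^ k := by positivity
  rw [component_apply, component_apply, tail, tail, h _ (by omega)]

theorem mergeBit_congr (w : ℕ → ℕ → Option (List Bool)) {p q : Baire} {n : ℕ}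
    (h : ∀ i ≤ 2 * n + 2, p i = q i) (o : List Bool) : mergeBit w p n o = mergeBit w q n o := by
  have : Absorbs w p n o ↔ Absorbs w q n o := by
    simp only [Absorbs, h 0 (by omega),
      componentBits_congr (p := p) (q := q) fun i (hi : i ≤ n) => h i (by omega)]
  rw [mergeBit, mergeBit, h _ le_rfl]
  classical exact if_congr this rfl rfl

theorem mergeWord_congr (w : ℕ → ℕ → Option (List Bool)) {p q : Baire} {n : ℕ}
    (h : ∀ i ≤ 2 * n, p i = q i) : mergeWord w p n = mergeWord w q n := by
  induction n with
  | zero => rfl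
  | succ n ih =>
    rw [mergeWord_succ, mergeWord_succ, ih fun i hi => h i (by omega),
      mergeBit_congr w fun i hi => h i (by omega)]

theorem primrec_two_pow {α : Type} [Primcodable α] {f : α → ℕ} (hf : Primrec f) :
    Primrec fun a => 2 ^ f a := by
  have h : Primrec₂ fun a b : ℕ => a ^ b := Primrec₂.unpaired'.1 Nat.Primrec.pow
  exact h.comp (Primrec.const 2) hf

theorem primrec_mergeBit {w : ℕ → ℕ → Option (List Bool)} (hw : Primrec₂ w) :
    Primrec fun x : List ℕ × ℕ × List Bool =>
      mergeBit w (fun i => x.1.getD i 0) x.2.1 x.2.2 := by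
  classical
  have hget : ∀ {α : Type} [Primcodable α] {u : α → List ℕ} {i : α → ℕ}, Primrec u → Primrec i →
      Primrec fun a => (u a).getD (i a) 0 := fun hu hi => (Primrec.list_getD 0).comp hu hi
  refine Primrec.ite ?_ (PrimrecPred.decide (Primrec.eq.comp (hget Primrec.fst ?_)
    (Primrec.const 1))) (Primrec.const false)
  · let β := ((List ℕ × ℕ × List Bool) × ℕ) × ℕ
    have hu : Primrec fun y : β => y.1.1.1 := Primrec.fst.comp (Primrec.fst.comp Primrec.fst)
    have hn : Primrec fun y : β => y.1.1.2.1 :=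
      Primrec.fst.comp (Primrec.snd.comp (Primrec.fst.comp Primrec.fst))
    have ho : Primrec fun y : β => y.1.1.2.2 :=
      Primrec.snd.comp (Primrec.snd.comp (Primrec.fst.comp Primrec.fst))
    have hc : Primrec fun y : β => y.1.2 := Primrec.snd.comp Primrec.fst
    have hbits : Primrec fun y : β =>
        componentBits (fun i => y.1.1.1.getD i 0) y.2 y.1.1.2.1 := by
      refine Primrec.list_map (Primrec.list_range.comp (Primrec.nat_div.comp hn
        (primrec_two_pow (Primrec.succ.comp Primrec.snd)))) ?_
      refine Primrec.of_eq (f := fun v : β × ℕ =>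
        decide (v.1.1.1.1.getD (2 ^ v.1.2 * (2 * v.2 + 1) + 1) 0 = 1)) ?_ fun v => ?_
      · exact PrimrecPred.decide (Primrec.eq.comp (hget (hu.comp Primrec.fst)
          (Primrec.succ.comp (Primrec.nat_mul.comp
            (primrec_two_pow (Primrec.snd.comp Primrec.fst))
            (Primrec.succ.comp (Primrec.nat_mul.comp (Primrec.const 2) Primrec.snd)))))
          (Primrec.const 1))
      · dsimp only
        rw [component_apply]
        rfl
    have hR : PrimrecPred fun y : β =>
        (CoveredBy w y.1.2 y.1.1.2.1 (componentBits (fun i => y.1.1.1.getD i 0) y.2 y.1.1.2.1) →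
          CoveredBy w y.1.2 y.1.1.2.1 y.1.1.2.2) :=
      ((primrecPred_coveredBy hw hc hn hbits).not.or
        (primrecPred_coveredBy hw hc hn ho)).of_eq fun y => imp_iff_not_or.symm
    exact PrimrecPred.forall_lt_param (PrimrecPred.forall_lt_param hR
      (hget (Primrec.fst.comp Primrec.fst) (Primrec.const 0)))
      (Primrec.fst.comp Primrec.snd)
  · exact Primrec.succ.comp (Primrec.succ.comp (Primrec.nat_mul.comp (Primrec.const 2)
      (Primrec.fst.comp Primrec.snd)))

theorem isComputable_mergeName {w : ℕ → ℕ → Option (List Bool)} (hw : Primrec₂ w) :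
    IsComputable fun p => Part.some (mergeName w p) := by
  refine isComputable_of_modulus (c := 3) (by norm_num) ?_ ?_
  · have hword : Primrec₂ fun (u : List ℕ) (n : ℕ) => mergeWord w (fun i => u.getD i 0) n := by
      refine Primrec.nat_rec (f := fun _ => ([] : List Bool)) (g := fun (u : List ℕ) y =>
        y.2 ++ [mergeBit w (fun i => u.getD i 0) y.1 y.2]) (Primrec.const []) ?_
      refine Primrec.list_concat.comp (Primrec.snd.comp Primrec.snd) ?_
      exact primrec_mergeBit hw
    have hseq : Primrec₂ fun (u : List ℕ) (n : ℕ) => mergeSeq w (fun i => u.getD i 0) n :=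
      (primrec_mergeBit hw).comp (Primrec.pair Primrec.fst (Primrec.pair Primrec.snd hword))
    have hnat : Primrec Bool.toNat := Primrec.dom_finite _
    refine Primrec.nat_casesOn Primrec.snd ?_ ?_
    · exact Primrec.nat_min.comp ((Primrec.list_getD 0).comp Primrec.fst (Primrec.const 0))
        (Primrec.const 1)
    · exact hnat.comp (hseq.comp (Primrec.fst.comp Primrec.fst) Primrec.snd)
  · rintro p q (_ | n) h
    · change min (p 0) 1 = min (q 0) 1
      rw [h 0 (by omega)]
    · change (mergeSeq w p n).toNat = (mergeSeq w q n).toNat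
      rw [mergeSeq, mergeSeq, mergeWord_congr w fun i hi => h i (by omega),
        mergeBit_congr w fun i hi => h i (by omega)]

/-- A name of a solution of the finite parallelization for the pair `t` of a name of the instance
and a name of a solution of the combined instance. -/
def splitName (t : Baire) : Baire :=
  -- For `t = pair p s` and `m = t 0`, the multiples of `2 ^ m` are the positions of the factor `X ^
  -- 0`, copied from `tail p`; everywhere else stands the common layer `t 3 = s 1`.
  cons (t 0) fun j => if j % 2 ^ t 0 = 0 then t (2 * j + 2) else t 3

theorem isComputable_splitName : IsComputable fun t => Part.some (splitName t) := by
  refine isComputable_of_modulus (c := 4) (by norm_num) ?_ ?_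
  · have hget : ∀ {α : Type} [Primcodable α] {u : α → List ℕ} {i : α → ℕ}, Primrec u →
        Primrec i → Primrec fun a => (u a).getD (i a) 0 :=
      fun hu hi => (Primrec.list_getD 0).comp hu hi
    refine Primrec.nat_casesOn Primrec.snd (hget Primrec.fst (Primrec.const 0)) ?_
    have hu : Primrec fun y : (List ℕ × ℕ) × ℕ => y.1.1 := Primrec.fst.comp Primrec.fst
    refine Primrec.ite ?_ (hget hu ?_) (hget hu (Primrec.const 3))
    · exact Primrec.eq.comp (Primrec.nat_mod.comp Primrec.snd
        (primrec_two_pow (hget hu (Primrec.const 0)))) (Primrec.const 0)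
    · exact Primrec.succ.comp (Primrec.succ.comp
        (Primrec.nat_mul.comp (Primrec.const 2) Primrec.snd))
  · rintro p q (_ | j) h
    · exact h 0 (by omega)
    · change (if j % 2 ^ p 0 = 0 then p (2 * j + 2) else p 3) =
        if j % 2 ^ q 0 = 0 then q (2 * j + 2) else q 3
      rw [h 0 (by omega), h (2 * j + 2) (by omega), h 3 (by omega)]

theorem tail_splitName_pair (p s : Baire) (j : ℕ) :
    tail (splitName (pair p s)) j = if j % 2 ^ p 0 = 0 then tail p j else s 1 := by
  have h : pair p s (2 * j + 2) = p (j + 1) :=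
    congrFun (evenPart_pair p s) (j + 1)
  change (if j % 2 ^ p 0 = 0 then pair p s (2 * j + 2) else s 1) = _
  rw [h]
  rfl

theorem iterate_evenPart_splitName (p s : Baire) :
    evenPart^[p 0] (tail (splitName (pair p s))) = evenPart^[p 0] (tail p) := by
  funext j
  rw [iterate_evenPart_apply, iterate_evenPart_apply, tail_splitName_pair,
    if_pos (Nat.mul_mod_right _ _)]

theorem component_splitName (p s : Baire) {k : ℕ} (hk : k < p 0) :
    component k (tail (splitName (pair p s))) 0 = s 1 := by
  rw [component_apply, tail_splitName_pair, if_neg]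
  -- The first entry of component `k` is at position `2 ^ k`, which is not a multiple of `2 ^ p 0`
  -- as `k < p 0`.
  rw [mul_zero, zero_add, mul_one, Nat.mod_eq_of_lt (Nat.pow_lt_pow_right one_lt_two hk)]
  positivity

theorem IsUniversalMLTest.star_reducible_id_sum_layer {U : ℕ → Set Cantor}
    (hU : IsUniversalMLTest U) : Reducible (layer U).star (idBaire.sum (layer U)) := by
  obtain ⟨w, hw, hUw⟩ := hU.1.1.exists_primrec
  refine ⟨_, _, isComputable_splitName, isComputable_mergeName hw, ?_⟩
  rintro G hG p ⟨m, x⟩ hx ⟨_, y, hy, -⟩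
  obtain ⟨rfl, hx⟩ := mk_mem_sigma_rep.1 hx
  have hcomp := fun k (hk : k < p 0) => component_mem_of_mem_dom hx ⟨y, hy⟩ hk
  -- One answer serves all entries of the tuple; for the empty tuple only its existence counts,
  -- since the solution is read off from `p`.
  have key : ∃ s ∈ G (mergeName w p), ∀ k < p 0,
      ∀ z ∈ cantorSpace.rep (component k (tail p)), z ∉ U (s 1) := by
    rcases Nat.eq_zero_or_pos (p 0) with h0 | h0
    · obtain ⟨s, hs, -⟩ := hG (mergeName w p) (Sum.inl (tail (mergeName w p)))
        (inl_mem_sum_rep.2 ⟨by simp [mergeName, cons_zero, h0], Part.mem_some _⟩)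
        ⟨_, _, rfl, rfl⟩
      exact ⟨s, hs, fun k hk => by omega⟩
    · have hrand : mergeSeq w p ∈ randomSet U := by
        refine mergeSeq_mem_randomSet hU hUw h0 fun k hk => ?_
        obtain ⟨z, hz, hzr⟩ := hcomp k hk
        obtain ⟨-, rfl⟩ := mem_cantor_rep.1 hz
        exact hzr
      rw [← dom_layer] at hrand
      obtain ⟨n, hn⟩ := hrand
      obtain ⟨s, hs, _, hv, n', hn', rfl⟩ := hG (mergeName w p) (Sum.inr (mergeSeq w p))
        (inr_mem_sum_rep.2 ⟨by simp [mergeName, cons_zero]; omega, mem_cantor_rep.2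
          ⟨fun i => by
            change (mergeSeq w p i).toNat = 0 ∨ (mergeSeq w p i).toNat = 1
            cases mergeSeq w p i <;> simp, by
            funext i
            change _ = decide ((mergeSeq w p i).toNat = 1)
            cases mergeSeq w p i <;> simp⟩⟩)
        ⟨_, n, hn, rfl⟩
      have hs1 : n' = s 1 := Part.mem_some_iff.1 (inr_mem_sum_rep.1 hv).2
      refine ⟨s, hs, fun k hk z hz hzU => hn' ?_⟩
      obtain ⟨-, rfl⟩ := mem_cantor_rep.1 hz
      rw [hs1]
      exact mergeSeq_mem hU hUw hk hzU
  obtain ⟨s, hs, hsU⟩ := key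
  obtain ⟨v, hv, hvx⟩ := exists_mem_pow_layer (U := U) (t := tail (splitName (pair p s))) hx
    (iterate_evenPart_splitName p s) fun k hk z hz => by
      rw [component_splitName p s hk]
      exact hsU k hk z hz
  refine ⟨splitName (pair p s), ?_, ⟨p 0, v⟩, mk_mem_sigma_rep.2 ⟨rfl, hv⟩, v, hvx, rfl⟩
  simp only [Part.bind_some, Part.mem_bind_iff]
  exact ⟨s, hs, Part.mem_some _⟩

end Weihrauch

end

theorem corollary12 (U : ℕ → Set Weihrauch.Cantor) (hU : Weihrauch.IsUniversalMLTest U) :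
    Weihrauch.StrictlyReducible (Weihrauch.layer U) (Weihrauch.layer U).star ∧
    Weihrauch.Equivalent (Weihrauch.layer U).star
      (Weihrauch.idBaire.sum (Weihrauch.layer U)) ∧
    Weihrauch.StrictlyReducible (Weihrauch.idBaire.sum (Weihrauch.layer U))
      Weihrauch.choiceNat ∧
    Weihrauch.StrictlyReducible (Weihrauch.layer U).star Weihrauch.choiceNat := by
  have hsum := Weihrauch.id_sum_layer_reducible_star U
  have hstar := hU.star_reducible_id_sum_layer
  have hchoice := Weihrauch.id_sum_layer_reducible_choiceNat hU.1.1
  exact ⟨⟨(Weihrauch.layer_reducible_id_sum_layer U).trans hsum, hU.not_star_reducible_layer⟩,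
    ⟨hstar, hsum⟩, ⟨hchoice, hU.not_choiceNat_reducible⟩,
    ⟨hstar.trans hchoice, fun h => hU.not_choiceNat_reducible (h.trans hstar)⟩⟩
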